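/- Let $(A,\mathfrak m)$ be a Gorenstein local ring with $d=\dim A>0$, let $Q$ be a parameter ideal of $A$ (an ideal generated by a system of parameters $a_1,\dots,a_d$ of $A$), and let $I=Q:\mathfrak m^2$. Let $n=\mathrm v(A/Q)$ be the embedding dimension of $A/Q$, that is, the length of $\mathfrak n/\mathfrak n^2$ for the maximal ideal $\mathfrak n$ of $A/Q$, and assume that $n>1$. If $I$ is not integral over $Q$ (that is, $I$ is not contained in the integral closure of $Q$), then $\mathrm e_{\mathfrak m}^0(A)\le 2$ and $n=2$, where $\mathrm e_{\mathfrak m}^0(A)=\lim_{k\to\infty} d!\,\ell_A(A/\mathfrak m^k)/k^d$ is the multiplicity of $A$ with respect to $\mathfrak m$. -/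

import Mathlib

universe u

/-- A Gorenstein local ring: a Noetherian local ring that has finite injective dimension as a
module over itself. -/
class IsGorensteinLocalRing (A : Type u) [CommRing A] : Prop extends
    IsLocalRing A, IsNoetherianRing A where
  exists_hasInjectiveDimensionLE :
    ∃ k : ℕ, CategoryTheory.HasInjectiveDimensionLE (ModuleCat.of A A) k

/-- `Q` is a parameter ideal of the local ring `A`: it is generated by `d = dim A` elements
and its radical is the maximal ideal. -/
def IsParameterIdeal {A : Type u} [CommRing A] [IsLocalRing A] (Q : Ideal A) : Prop :=
  ∃ (d : ℕ) (a : Fin d → A), ringKrullDim A = d ∧ Q = Ideal.span (Set.range a) ∧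
    Q.radical = IsLocalRing.maximalIdeal A

theorem IsParameterIdeal.isLocalRing_quotient {A : Type u} [CommRing A] [IsLocalRing A]
    {Q : Ideal A} (hQ : IsParameterIdeal Q) : IsLocalRing (A ⧸ Q) := by
  obtain ⟨d, a, -, -, h⟩ := hQ
  have hne : Q ≠ ⊤ := by
    rintro rfl
    rw [Ideal.radical_top] at h
    exact (IsLocalRing.maximalIdeal.isMaximal A).ne_top h.symm
  have : Nontrivial (A ⧸ Q) := Ideal.Quotient.nontrivial_iff.mpr hne
  exact IsLocalRing.of_surjective' (Ideal.Quotient.mk Q) Ideal.Quotient.mk_surjective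

/-- The embedding dimension `v(R) = ℓ_R(𝔪/𝔪²)` of a local ring `(R, 𝔪)`. -/
noncomputable def embeddingDim (R : Type u) [CommRing R] [IsLocalRing R] : ℕ∞ :=
  Module.length R (IsLocalRing.CotangentSpace R)

/-- The multiplicity `e_𝔪⁰(A) = lim_{k → ∞} d! · ℓ_A(A/𝔪ᵏ) / kᵈ`, `d = dim A`, of a Noetherian local
ring `(A, 𝔪)` with respect to its maximal ideal. The limit always exists for such a ring (the
length is eventually a polynomial in `k` of degree `d`); it is written as an upper limit in
`[0, ∞]` so that no convention for missing limits enters. -/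
noncomputable def localMultiplicity (A : Type u) [CommRing A] [IsLocalRing A] : ENNReal :=
  let d : ℕ := ((ringKrullDim A).unbotD 0).toNat
  Filter.limsup (fun k : ℕ =>
    (d.factorial : ENNReal) *
      ((Module.length A (A ⧸ IsLocalRing.maximalIdeal A ^ k) : ℕ∞) : ENNReal) / (k : ENNReal) ^ d)
    Filter.atTop

/-- `x` is integral over the ideal `Q`: it satisfies an equation
`x ^ k + c₁ x ^ (k - 1) + ⋯ + c_k = 0` with `c_i ∈ Q ^ i`. -/
def IsIntegralOverIdeal {A : Type u} [CommRing A] (Q : Ideal A) (x : A) : Prop :=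
  ∃ p : Polynomial A, p.Monic ∧
    (∀ i ≤ p.natDegree, p.coeff i ∈ Q ^ (p.natDegree - i)) ∧ p.eval x = 0

section TorsionBy

open CategoryTheory

variable {R : Type u} [CommRing R] (x : R)

theorem Module.Injective.torsionBy {E : Type u} [AddCommGroup E] [Module R E]
    [Module.Injective R E] :
    Module.Injective (R ⧸ R ∙ x) (Submodule.torsionBy R E x) := by
  apply Module.Baer.injective
  intro I g
  have hsm : ∀ (r : R) (t : I), (Ideal.Quotient.mk (R ∙ x) r) • t = r • t := by
    intro r t
    ext
    simp [Algebra.smul_def]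
  let gR : I →ₗ[R] E :=
    { toFun := fun i => (g i : E)
      map_add' := by intros; simp
      map_smul' := by
        intro r i
        have := g.map_smul (Ideal.Quotient.mk (R ∙ x) r) i
        rw [hsm] at this
        rw [this]
        rfl }
  let jR : I →ₗ[R] (R ⧸ R ∙ x) :=
    { toFun := fun i => i
      map_add' := by intros; rfl
      map_smul' := by intro r i; rfl }
  obtain ⟨h, hh⟩ := Module.Injective.extension_property R E I (R ⧸ R ∙ x) jR
    (fun a b hab => Subtype.ext hab) gR
  have h1 : h 1 ∈ Submodule.torsionBy R E x := by
    rw [Submodule.mem_torsionBy_iff, ← map_smul]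
    have : x • (1 : R ⧸ R ∙ x) = 0 := by
      rw [Algebra.smul_def, mul_one]
      exact Ideal.Quotient.eq_zero_iff_mem.mpr (Ideal.mem_span_singleton_self x)
    rw [this, map_zero]
  refine ⟨LinearMap.toSpanSingleton _ _ ⟨h 1, h1⟩, fun i hi => ?_⟩
  apply Subtype.ext
  have h2 : h i = (g ⟨i, hi⟩ : E) := LinearMap.congr_fun hh ⟨i, hi⟩
  rw [← h2]
  obtain ⟨r, rfl⟩ := Ideal.Quotient.mk_surjective i
  have : (Ideal.Quotient.mk (R ∙ x) r) = r • (1 : R ⧸ R ∙ x) := by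
    rw [Algebra.smul_def, mul_one]; rfl
  conv_rhs => rw [this, map_smul]
  rfl

/-- The map induced on `x`-torsion by a linear map, linear over `R ⧸ (x)`. -/
def LinearMap.torsionByMap {M N : Type u} [AddCommGroup M] [Module R M] [AddCommGroup N]
    [Module R N] (f : M →ₗ[R] N) :
    Submodule.torsionBy R M x →ₗ[R ⧸ R ∙ x] Submodule.torsionBy R N x where
  toFun m := ⟨f m, by
    rw [Submodule.mem_torsionBy_iff, ← map_smul, (Submodule.mem_torsionBy_iff x _).mp m.2,
      map_zero]⟩
  map_add' a b := by ext; simp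
  map_smul' s a := by
    obtain ⟨r, rfl⟩ := Ideal.Quotient.mk_surjective s
    ext
    exact f.map_smul r a

@[simp] theorem LinearMap.coe_torsionByMap {M N : Type u} [AddCommGroup M] [Module R M]
    [AddCommGroup N] [Module R N] (f : M →ₗ[R] N) (m : Submodule.torsionBy R M x) :
    (LinearMap.torsionByMap x f m : N) = f m := rfl

variable {x}

theorem Module.Injective.exists_smul_eq (hx : x ∈ nonZeroDivisors R) {E : Type u} [AddCommGroup E]
    [Module R E] [Module.Injective R E] (e : E) : ∃ e', x • e' = e := by
  obtain ⟨h, hh⟩ := Module.Injective.extension_property R E R R (LinearMap.mulLeft R x)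
    (fun a b hab => by
      have hab : x * a = x * b := hab
      rw [← sub_eq_zero, ← mul_sub] at hab
      exact sub_eq_zero.mp (mem_nonZeroDivisors_iff_left.mp hx _ hab))
    (LinearMap.toSpanSingleton R E e)
  refine ⟨h 1, ?_⟩
  have := LinearMap.congr_fun hh 1
  simpa [← map_smul] using this

theorem hasInjectiveDimensionLE_torsionBy (hx : x ∈ nonZeroDivisors R) (n : ℕ) :
    ∀ (C : Type u) [AddCommGroup C] [Module R C],
    (∀ c : C, ∃ c', x • c' = c) → HasInjectiveDimensionLE (ModuleCat.of R C) n →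
    HasInjectiveDimensionLE (ModuleCat.of (R ⧸ R ∙ x) (Submodule.torsionBy R C x)) n := by
  induction n with
  | zero =>
    intro C _ _ _ h
    rw [HasInjectiveDimensionLE, zero_add, ← injective_iff_hasInjectiveDimensionLT_one,
      ← Module.injective_iff_injective_object] at h ⊢
    exact Module.Injective.torsionBy x
  | succ n ih =>
    intro C _ _ hC h
    let ⟨E, _, f, _⟩ := EnoughInjectives.presentation (ModuleCat.of R C)
    have : Module.Injective R E := Module.injective_module_of_injective_object R E
    have injf : Function.Injective f.hom := (ModuleCat.mono_iff_injective f).mp ‹_›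
    let S : ShortComplex (ModuleCat.{u} R) :=
      ModuleCat.shortComplexOfCompEqZero _ _ f.hom.exact_map_mkQ_range.linearMap_comp_eq_zero
    have exactS := ModuleCat.shortComplex_shortExact S
      f.hom.exact_map_mkQ_range injf (Submodule.mkQ_surjective _)
    have hD := (exactS.hasInjectiveDimensionLT_X₃_iff n inferInstance).mpr h
    have hT := ih (E ⧸ LinearMap.range f.hom) (fun c => by
      obtain ⟨e, rfl⟩ := Submodule.mkQ_surjective _ c
      obtain ⟨e', rfl⟩ := Module.Injective.exists_smul_eq hx e
      exact ⟨Submodule.mkQ _ e', by rw [map_smul]⟩) hD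
    let f' := LinearMap.torsionByMap x f.hom
    let g' := LinearMap.torsionByMap x (LinearMap.range f.hom).mkQ
    have exact' : Function.Exact f' g' := by
      intro e
      rw [Subtype.ext_iff]
      simp only [g', LinearMap.coe_torsionByMap, Submodule.coe_zero, Submodule.mkQ_apply,
        Submodule.Quotient.mk_eq_zero]
      constructor
      · rintro ⟨c, hc⟩
        refine ⟨⟨c, ?_⟩, Subtype.ext hc⟩
        rw [Submodule.mem_torsionBy_iff]
        apply injf
        rw [map_smul, hc, map_zero]
        exact (Submodule.mem_torsionBy_iff x _).mp e.2
      · rintro ⟨c, rfl⟩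
        exact ⟨c, rfl⟩
    let S' : ShortComplex (ModuleCat.{u} (R ⧸ R ∙ x)) :=
      ModuleCat.shortComplexOfCompEqZero f' g' exact'.linearMap_comp_eq_zero
    have exactS' := ModuleCat.shortComplex_shortExact S' exact'
      (fun a b hab => Subtype.ext (injf (congrArg Subtype.val hab))) (by
        rintro ⟨d, hd⟩
        obtain ⟨e, rfl⟩ := Submodule.mkQ_surjective _ d
        rw [Submodule.mem_torsionBy_iff, ← map_smul, Submodule.mkQ_apply,
          Submodule.Quotient.mk_eq_zero] at hd
        obtain ⟨c, hc⟩ := hd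
        obtain ⟨c', rfl⟩ := hC c
        refine ⟨⟨e - f.hom c', ?_⟩, ?_⟩
        · rw [Submodule.mem_torsionBy_iff, smul_sub, ← hc, map_smul, sub_self]
        · apply Subtype.ext
          change (LinearMap.range f.hom).mkQ (e - f.hom c') = (LinearMap.range f.hom).mkQ e
          rw [map_sub, sub_eq_self, Submodule.mkQ_apply, Submodule.Quotient.mk_eq_zero]
          exact ⟨c', rfl⟩)
    have hinj : Injective S'.X₂ := by
      have : Module.Injective (R ⧸ R ∙ x) (Submodule.torsionBy R E x) :=
        Module.Injective.torsionBy x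
      exact Module.injective_object_of_injective_module _ _
    exact (exactS'.hasInjectiveDimensionLT_X₃_iff n hinj).mp hT

/-- Finite injective dimension passes to the quotient by a nonzerodivisor. -/
theorem hasInjectiveDimensionLE_quotient_span_singleton (hx : x ∈ nonZeroDivisors R) (n : ℕ)
    (h : HasInjectiveDimensionLE (ModuleCat.of R R) n) :
    HasInjectiveDimensionLE (ModuleCat.of (R ⧸ R ∙ x) (R ⧸ R ∙ x)) n := by
  let ⟨E, _, f, _⟩ := EnoughInjectives.presentation (ModuleCat.of R R)
  have : Module.Injective R E := Module.injective_module_of_injective_object R E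
  have injf : Function.Injective f.hom := (ModuleCat.mono_iff_injective f).mp ‹_›
  let C := E ⧸ LinearMap.range f.hom
  let S : ShortComplex (ModuleCat.{u} R) :=
    ModuleCat.shortComplexOfCompEqZero _ _ f.hom.exact_map_mkQ_range.linearMap_comp_eq_zero
  have exactS := ModuleCat.shortComplex_shortExact S
    f.hom.exact_map_mkQ_range injf (Submodule.mkQ_surjective _)
  have hC : HasInjectiveDimensionLE (ModuleCat.of R C) n := by
    apply exactS.hasInjectiveDimensionLT_X₃
    · exact hasInjectiveDimensionLT_of_ge S.X₂ 1 (n + 1) (by lia)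
    · exact hasInjectiveDimensionLT_of_ge S.X₁ (n + 1) (n + 1 + 1) (by lia)
  have hT := hasInjectiveDimensionLE_torsionBy hx n C (fun c => by
      obtain ⟨e, rfl⟩ := Submodule.mkQ_surjective _ c
      obtain ⟨e', rfl⟩ := Module.Injective.exists_smul_eq hx e
      exact ⟨Submodule.mkQ _ e', by rw [map_smul]⟩) hC
  have hxR : ∀ r : R, x • f.hom r = 0 → r = 0 := by
    intro r hr
    rw [← map_smul] at hr
    exact mem_nonZeroDivisors_iff_left.mp hx r (injf (hr.trans (map_zero _).symm))
  let g' := LinearMap.torsionByMap x (LinearMap.range f.hom).mkQ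
  have injg' : Function.Injective g' := by
    rw [injective_iff_map_eq_zero]
    intro e he
    have he := congrArg Subtype.val he
    change (LinearMap.range f.hom).mkQ e = 0 at he
    rw [Submodule.mkQ_apply, Submodule.Quotient.mk_eq_zero] at he
    obtain ⟨r, hr⟩ := he
    have h0 := (Submodule.mem_torsionBy_iff x _).mp e.2
    rw [← hr] at h0
    have : r = 0 := hxR r h0
    apply Subtype.ext
    rw [← hr, this, map_zero]
    rfl
  obtain ⟨e₀, he₀⟩ := Module.Injective.exists_smul_eq hx (f.hom (1 : R))
  have hf : ∀ r : R, f.hom r = r • x • e₀ := by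
    intro r
    rw [he₀, ← map_smul, smul_eq_mul, mul_one]
  have hc₀ : (LinearMap.range f.hom).mkQ e₀ ∈ Submodule.torsionBy R C x := by
    rw [Submodule.mem_torsionBy_iff, ← map_smul, he₀, Submodule.mkQ_apply,
      Submodule.Quotient.mk_eq_zero]
    exact ⟨1, rfl⟩
  let ψ : (R ⧸ R ∙ x) →ₗ[R ⧸ R ∙ x] (Submodule.torsionBy R C x ⧸ LinearMap.range g') :=
    (LinearMap.range g').mkQ ∘ₗ LinearMap.toSpanSingleton _ _ ⟨_, hc₀⟩
  have hψ : Function.Bijective ψ := by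
    constructor
    · rw [injective_iff_map_eq_zero]
      intro a ha
      obtain ⟨r, rfl⟩ := Ideal.Quotient.mk_surjective a
      simp only [ψ, LinearMap.comp_apply, Submodule.mkQ_apply, Submodule.Quotient.mk_eq_zero] at ha
      obtain ⟨e, he⟩ := ha
      have he := congrArg Subtype.val he
      change (LinearMap.range f.hom).mkQ e = r • (LinearMap.range f.hom).mkQ e₀ at he
      rw [← map_smul, ← sub_eq_zero, ← map_sub, Submodule.mkQ_apply,
        Submodule.Quotient.mk_eq_zero] at he
      obtain ⟨s, hs⟩ := he
      have h0 := (Submodule.mem_torsionBy_iff x _).mp e.2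
      have h2 : f.hom (-r) = f.hom (x * s) := by
        rw [← smul_eq_mul x s, map_smul, hs, smul_sub, h0, zero_sub, hf, neg_smul, smul_comm]
      have h3 := injf h2
      rw [Ideal.Quotient.eq_zero_iff_mem, ← neg_mem_iff, h3]
      exact Ideal.mul_mem_right _ _ (Ideal.mem_span_singleton_self x)
    · intro c
      obtain ⟨⟨c, hc⟩, rfl⟩ := Submodule.mkQ_surjective _ c
      obtain ⟨e, rfl⟩ := Submodule.mkQ_surjective _ c
      rw [Submodule.mem_torsionBy_iff, ← map_smul, Submodule.mkQ_apply,
        Submodule.Quotient.mk_eq_zero] at hc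
      obtain ⟨r, hr⟩ := hc
      refine ⟨Ideal.Quotient.mk _ r, ?_⟩
      simp only [ψ, LinearMap.comp_apply]
      rw [← sub_eq_zero, ← map_sub, Submodule.mkQ_apply, Submodule.Quotient.mk_eq_zero]
      refine ⟨⟨r • e₀ - e, ?_⟩, ?_⟩
      · rw [Submodule.mem_torsionBy_iff, smul_sub, ← hr, hf, smul_comm, sub_self]
      · apply Subtype.ext
        change (LinearMap.range f.hom).mkQ (r • e₀ - e) = _
        rw [map_sub, map_smul]
        rfl
  let S' : ShortComplex (ModuleCat.{u} (R ⧸ R ∙ x)) :=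
    ModuleCat.shortComplexOfCompEqZero _ _ g'.exact_map_mkQ_range.linearMap_comp_eq_zero
  have exactS' := ModuleCat.shortComplex_shortExact S' g'.exact_map_mkQ_range injg'
    (Submodule.mkQ_surjective _)
  have hinj : Injective S'.X₁ := by
    have : Module.Injective (R ⧸ R ∙ x) (Submodule.torsionBy R E x) :=
      Module.Injective.torsionBy x
    exact Module.injective_object_of_injective_module _ _
  have h₃ : HasInjectiveDimensionLT S'.X₃ (n + 1) := by
    apply exactS'.hasInjectiveDimensionLT_X₃
    · exact hT
    · exact hasInjectiveDimensionLT_of_ge S'.X₁ 1 (n + 1 + 1) (by lia)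
  exact (ModuleCat.hasInjectiveDimensionLE_iff_of_linearEquiv (LinearEquiv.ofBijective ψ hψ) n).mpr
    h₃

end TorsionBy

section DepthZero

open CategoryTheory Abelian

variable {R : Type u} [CommRing R]

/-- Injective dimension can be tested on finitely generated modules. -/
theorem hasInjectiveDimensionLE_of_forall_finite (n : ℕ) : ∀ N : ModuleCat.{u} R,
    (∀ M : ModuleCat.{u} R, Module.Finite R M → Subsingleton (Ext M N (n + 1))) →
    HasInjectiveDimensionLE N n := by
  induction n with
  | zero =>
    intro N h
    rw [HasInjectiveDimensionLE, zero_add, ← injective_iff_hasInjectiveDimensionLT_one]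
    suffices Module.Injective R N from Module.injective_object_of_injective_module R N
    apply Module.Baer.injective
    intro I g
    let S : ShortComplex (ModuleCat.{u} R) :=
      ModuleCat.shortComplexOfCompEqZero I.subtype I.mkQ
        (LinearMap.exact_subtype_mkQ I).linearMap_comp_eq_zero
    have hS : S.ShortExact := ModuleCat.shortComplex_shortExact S
      (LinearMap.exact_subtype_mkQ I) I.injective_subtype I.mkQ_surjective
    have := h (ModuleCat.of R (R ⧸ I)) inferInstance
    obtain ⟨φ, hφ⟩ := Ext.contravariant_sequence_exact₁ hS N
      (Ext.mk₀ (ModuleCat.ofHom g : S.X₁ ⟶ N)) (n₁ := 1) (by rfl)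
      (Subsingleton.elim (α := Ext S.X₃ N 1) _ _)
    obtain ⟨φ, rfl⟩ := Ext.homEquiv₀.symm.surjective φ
    have hφ' : S.f ≫ φ = ModuleCat.ofHom g := Ext.homEquiv₀.symm.injective (by simpa using hφ)
    refine ⟨φ.hom, fun x hx => ?_⟩
    exact LinearMap.congr_fun (congrArg ModuleCat.Hom.hom hφ') ⟨x, hx⟩
  | succ n ih =>
    intro N h
    let ⟨E, _, f, _⟩ := EnoughInjectives.presentation N
    have injf : Function.Injective f.hom := (ModuleCat.mono_iff_injective f).mp ‹_›
    let S : ShortComplex (ModuleCat.{u} R) :=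
      ModuleCat.shortComplexOfCompEqZero _ _ f.hom.exact_map_mkQ_range.linearMap_comp_eq_zero
    have exactS := ModuleCat.shortComplex_shortExact S
      f.hom.exact_map_mkQ_range injf (Submodule.mkQ_surjective _)
    have : Injective S.X₂ := ‹Injective E›
    refine (exactS.hasInjectiveDimensionLT_X₃_iff n inferInstance).mp (ih _ fun M hM => ?_)
    have := h M hM
    refine subsingleton_of_forall_eq 0 fun e => ?_
    obtain ⟨e', rfl⟩ := Ext.covariant_sequence_exact₃ _ exactS e rfl
      (Subsingleton.elim (α := Ext M N (n + 2)) _ _)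
    rw [Ext.eq_zero_of_injective e', Ext.zero_comp]

variable [IsLocalRing R]

open IsLocalRing

/-- The double annihilator property. -/
theorem exists_mul_eq_zero_of_injective_self [Module.Injective R R] {s : R} (hs : s ≠ 0)
    (hms : ∀ r ∈ maximalIdeal R, r * s = 0) {K : Ideal R} {w : R} (hw : w ∉ K) :
    ∃ r, (∀ k ∈ K, r * k = 0) ∧ r * w ≠ 0 := by
  let L : Ideal R := K.colon {w}
  have hL : L ≤ maximalIdeal R := by
    apply le_maximalIdeal
    rw [Ne, Ideal.eq_top_iff_one, Submodule.mem_colon_singleton, one_smul]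
    exact hw
  let i : (R ⧸ L) →ₗ[R] (R ⧸ K) :=
    L.liftQ (LinearMap.toSpanSingleton R _ (Ideal.Quotient.mk K w)) (fun r hr => by
      have : Ideal.Quotient.mk K (r * w) = 0 :=
        Ideal.Quotient.eq_zero_iff_mem.mpr (Submodule.mem_colon_singleton.mp hr)
      exact this)
  have hi : Function.Injective i := by
    refine LinearMap.ker_eq_bot.mp (Submodule.ker_liftQ_eq_bot _ _ _ fun r hr => ?_)
    have hr : Ideal.Quotient.mk K (r * w) = 0 := hr
    exact Submodule.mem_colon_singleton.mpr (Ideal.Quotient.eq_zero_iff_mem.mp hr)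
  let g : (R ⧸ L) →ₗ[R] R :=
    L.liftQ (LinearMap.toSpanSingleton R R s) (fun r hr => by simpa using hms r (hL hr))
  obtain ⟨h, hh⟩ := Module.Injective.extension_property R R _ _ i hi g
  have hmk : ∀ a : R, h (Ideal.Quotient.mk K a) = h 1 * a := by
    intro a
    have : Ideal.Quotient.mk K a = a • (1 : R ⧸ K) := by
      rw [Algebra.smul_def, mul_one]; rfl
    rw [this, map_smul, smul_eq_mul, mul_comm]
  refine ⟨h 1, fun k hk => ?_, ?_⟩
  · rw [← hmk, Ideal.Quotient.eq_zero_iff_mem.mpr hk, map_zero]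
  · rw [← hmk]
    have h1 := LinearMap.congr_fun hh (Ideal.Quotient.mk L 1)
    have h2 : i (Ideal.Quotient.mk L 1) = Ideal.Quotient.mk K w := by
      change (1 : R) • Ideal.Quotient.mk K w = _
      rw [one_smul]
    have h3 : g (Ideal.Quotient.mk L 1) = s := by
      change (1 : R) • s = _
      rw [one_smul]
    rw [LinearMap.comp_apply, h2, h3] at h1
    rwa [h1]

variable [IsNoetherianRing R]

/-- Bass' lemma. -/
theorem subsingleton_ext_quotient_prime {N : ModuleCat.{u} R} [Module.Finite R N] (n : ℕ)
    (hk : Subsingleton (Ext (ModuleCat.of R (R ⧸ maximalIdeal R)) N n))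
    (hN : HasInjectiveDimensionLT N (n + 1)) (p : Ideal R) [p.IsPrime] :
    Subsingleton (Ext (ModuleCat.of R (R ⧸ p)) N n) := by
  by_cases hp : p = maximalIdeal R
  · rwa [hp]
  obtain ⟨x, hxm, hxp⟩ : ∃ x ∈ maximalIdeal R, x ∉ p := by
    by_contra! h
    exact hp (le_antisymm (le_maximalIdeal (Ideal.IsPrime.ne_top ‹_›)) h)
  have hreg : IsSMulRegular (ModuleCat.of R (R ⧸ p)) x := by
    intro a b hab
    obtain ⟨a, rfl⟩ := Ideal.Quotient.mk_surjective a
    obtain ⟨b, rfl⟩ := Ideal.Quotient.mk_surjective b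
    have hab : Ideal.Quotient.mk p (x * a) = Ideal.Quotient.mk p (x * b) := hab
    rw [Ideal.Quotient.eq, ← mul_sub] at hab
    exact Ideal.Quotient.eq.mpr ((Ideal.IsPrime.mem_or_mem ‹_› hab).resolve_left hxp)
  have hS := hreg.smulShortComplex_shortExact
  have hsurj : ∀ e : Ext (ModuleCat.of R (R ⧸ p)) N n, ∃ e', x • e' = e := by
    intro e
    obtain ⟨e', he'⟩ := Ext.contravariant_sequence_exact₁ hS N e rfl
      (Ext.eq_zero_of_hasInjectiveDimensionLT _ (n + 1) (by lia))
    refine ⟨e', ?_⟩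
    have h1 : ∀ e' : Ext (ModuleCat.of R (R ⧸ p)) N n,
        (Ext.mk₀ (x • 𝟙 (ModuleCat.of R (R ⧸ p)))).comp e' (zero_add n) = x • e' := by
      intro e'
      rw [Ext.mk₀_smul, Ext.smul_comp, Ext.mk₀_id_comp]
    exact (h1 e').symm.trans he'
  have htop : (⊤ : Submodule R (Ext (ModuleCat.of R (R ⧸ p)) N n)) = ⊥ := by
    apply Submodule.eq_bot_of_le_smul_of_le_jacobson_bot (maximalIdeal R) _ Module.Finite.fg_top
    · intro e _
      obtain ⟨e', rfl⟩ := hsurj e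
      exact Submodule.smul_mem_smul hxm trivial
    · rw [jacobson_eq_maximalIdeal _ bot_ne_top]
  exact subsingleton_of_forall_eq 0 fun e => by
    rw [← Submodule.mem_bot R, ← htop]
    trivial

theorem hasInjectiveDimensionLT_of_subsingleton_ext_residue {N : ModuleCat.{u} R}
    [Module.Finite R N] (n : ℕ)
    (hk : Subsingleton (Ext (ModuleCat.of R (R ⧸ maximalIdeal R)) N (n + 1)))
    (hN : HasInjectiveDimensionLT N (n + 2)) : HasInjectiveDimensionLE N n := by
  apply hasInjectiveDimensionLE_of_forall_finite
  intro M hM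
  suffices ∀ (M : Type u) [AddCommGroup M] [Module R M], Module.Finite R M →
    Subsingleton (Ext (ModuleCat.of R M) N (n + 1)) from this M hM
  intro M _ _ hM
  induction hM using IsNoetherianRing.induction_on_isQuotientEquivQuotientPrime R with
  | subsingleton M =>
    refine subsingleton_of_forall_eq 0 fun e => ?_
    have : (𝟙 (ModuleCat.of R M)) = 0 := by ext a; exact Subsingleton.elim (α := M) _ _
    rw [← e.mk₀_id_comp, this, Ext.mk₀_zero, Ext.zero_comp]
  | quotient M p f =>
    have := subsingleton_ext_quotient_prime (n + 1) hk hN p.1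
    refine subsingleton_of_forall_eq 0 fun e => ?_
    have hid := f.toModuleIso.hom_inv_id
    rw [← e.mk₀_id_comp, ← hid, ← Ext.mk₀_comp_mk₀, Ext.comp_assoc_of_second_deg_zero]
    rw [Subsingleton.elim ((Ext.mk₀ f.toModuleIso.inv).comp e _) 0, Ext.comp_zero]
  | exact N₁ N₂ N₃ f g hf hg hfg h₁ h₃ =>
    let S : ShortComplex (ModuleCat.{u} R) :=
      ModuleCat.shortComplexOfCompEqZero f g hfg.linearMap_comp_eq_zero
    have hS : S.ShortExact := ModuleCat.shortComplex_shortExact S hfg hf hg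
    refine subsingleton_of_forall_eq 0 fun e => ?_
    obtain ⟨e', rfl⟩ := Ext.contravariant_sequence_exact₂ hS N e
      (Subsingleton.elim (α := Ext (ModuleCat.of R N₁) N (n + 1)) _ _)
    rw [Subsingleton.elim (α := Ext (ModuleCat.of R N₃) N (n + 1)) e' 0, Ext.comp_zero]

/-- A local ring of depth zero and finite self-injective dimension is self-injective. -/
theorem injective_self_of_mul_eq_zero {s : R} (hs : s ≠ 0)
    (hms : ∀ r ∈ maximalIdeal R, r * s = 0) (n : ℕ)
    (h : HasInjectiveDimensionLE (ModuleCat.of R R) n) : Module.Injective R R := by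
  induction n with
  | zero =>
    rw [HasInjectiveDimensionLE, zero_add, ← injective_iff_hasInjectiveDimensionLT_one] at h
    exact Module.injective_module_of_injective_object R R
  | succ n ih =>
    apply ih
    apply hasInjectiveDimensionLT_of_subsingleton_ext_residue n _ h
    let f : (R ⧸ maximalIdeal R) →ₗ[R] R :=
      (maximalIdeal R).liftQ (LinearMap.toSpanSingleton R R s) (fun r hr => by
        simpa using hms r hr)
    have injf : Function.Injective f := by
      rw [← LinearMap.ker_eq_bot, Submodule.ker_liftQ_eq_bot]
      intro r hr
      by_contra hrm
      have hu : IsUnit r := by simpa using hrm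
      have : r * s = 0 := by simpa using hr
      exact hs (hu.mul_right_eq_zero.mp this)
    let S : ShortComplex (ModuleCat.{u} R) :=
      ModuleCat.shortComplexOfCompEqZero _ _ f.exact_map_mkQ_range.linearMap_comp_eq_zero
    have hS : S.ShortExact := ModuleCat.shortComplex_shortExact S
      f.exact_map_mkQ_range injf (Submodule.mkQ_surjective _)
    have : Projective S.X₂ := ModuleCat.projective_of_free (Module.Basis.singleton Unit R)
    refine subsingleton_of_forall_eq 0 fun e => ?_
    obtain ⟨e', rfl⟩ := Ext.contravariant_sequence_exact₁ hS (ModuleCat.of R R) e rfl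
      (Ext.eq_zero_of_hasInjectiveDimensionLT _ (n + 2) (by lia))
    rw [Ext.eq_zero_of_projective e', Ext.comp_zero]

/-- A Noetherian local ring with the double annihilator property has nilpotent maximal ideal. -/
theorem exists_maximalIdeal_pow_eq_bot
    (h : ∀ (K : Ideal R) (w : R), w ∉ K → ∃ r, (∀ k ∈ K, r * k = 0) ∧ r * w ≠ 0) :
    ∃ n, maximalIdeal R ^ n = ⊥ := by
  obtain ⟨n, hn⟩ := monotone_stabilizes_iff_noetherian.mpr ‹IsNoetherianRing R›
    ⟨fun n => Module.annihilator R (maximalIdeal R ^ n : Ideal R), fun a b hab r hr => by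
      rw [Submodule.mem_annihilator] at hr ⊢
      exact fun x hx => hr x (Ideal.pow_le_pow_right hab hx)⟩
  refine ⟨n, ?_⟩
  apply Submodule.eq_bot_of_le_smul_of_le_jacobson_bot (maximalIdeal R) _
    (IsNoetherian.noetherian _)
  · intro w hw
    rw [smul_eq_mul, ← pow_succ']
    by_contra hw'
    obtain ⟨r, hr, hrw⟩ := h _ w hw'
    have h1 : r ∈ Module.annihilator R (maximalIdeal R ^ n : Ideal R) := by
      have h2 : r ∈ Module.annihilator R (maximalIdeal R ^ (n + 1) : Ideal R) :=
        Submodule.mem_annihilator.mpr hr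
      have := hn (n + 1) (by lia)
      exact (congrArg (r ∈ ·) this).mpr h2
    exact hrw (Submodule.mem_annihilator.mp h1 w hw)
  · rw [jacobson_eq_maximalIdeal _ bot_ne_top]

end DepthZero

section Dimension

open CategoryTheory IsLocalRing

theorem ringKrullDim_eq_zero_of_maximalIdeal_pow_eq_bot {R : Type u} [CommRing R] [IsLocalRing R]
    {n : ℕ} (hn : maximalIdeal R ^ n = ⊥) : ringKrullDim R = 0 := by
  rw [← ringKrullDimZero_iff_ringKrullDim_eq_zero, Ring.krullDimLE_zero_iff]
  intro p hp
  have : p = maximalIdeal R :=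
    le_antisymm (le_maximalIdeal hp.ne_top) (hp.le_of_pow_le (hn.trans_le bot_le))
  rw [this]
  infer_instance

theorem exists_ringKrullDim_eq_natCast (R : Type u) [CommRing R] [IsLocalRing R]
    [IsNoetherianRing R] : ∃ d : ℕ, ringKrullDim R = d := by
  have h1 : ringKrullDim R ≠ ⊥ := ringKrullDim_ne_bot
  have h2 : ringKrullDim R ≠ ⊤ := ringKrullDim_ne_top
  obtain ⟨e, he⟩ := WithBot.ne_bot_iff_exists.mp h1
  rw [← he] at h2 ⊢
  have h3 : e ≠ ⊤ := by
    rintro rfl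
    exact h2 rfl
  obtain ⟨d, rfl⟩ := ENat.ne_top_iff_exists.mp h3
  exact ⟨d, rfl⟩

theorem ringKrullDim_le_quotient_of_mul_eq_zero (d : ℕ) : ∀ (R : Type u) [CommRing R]
    [IsLocalRing R] [IsNoetherianRing R] (n : ℕ), HasInjectiveDimensionLE (ModuleCat.of R R) n →
    ringKrullDim R = d → ∀ (p : Ideal R) (z : R), z ≠ 0 → (∀ r ∈ p, r * z = 0) →
    ringKrullDim R ≤ ringKrullDim (R ⧸ p) := by
  induction d with
  | zero =>
    intro R _ _ _ n _ hd p z hz hpz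
    rw [hd]
    have : Nontrivial (R ⧸ p) := Ideal.Quotient.nontrivial_iff.mpr (by
      rintro rfl
      exact hz (by simpa using hpz 1 trivial))
    exact ringKrullDim_nonneg_of_nontrivial
  | succ d ih =>
    intro R _ _ _ n hn hd p z hz hpz
    obtain ⟨q, hq, hzq⟩ := exists_le_isAssociatedPrime_of_isNoetherianRing R z hz
    obtain ⟨hqp, y, hqy⟩ := isAssociatedPrime_iff.mp hq
    have hpq : p ≤ q := fun r hr => hzq (by
      rw [Submodule.mem_colon_singleton]
      exact hpz r hr)
    refine le_trans ?_ (ringKrullDim_le_of_surjective (Ideal.Quotient.factor hpq)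
      (Ideal.Quotient.factor_surjective hpq))
    have hy0 : y ≠ 0 := by
      rintro rfl
      exact hqp.ne_top (by rw [hqy]; simp)
    have hqy0 : ∀ r ∈ q, r * y = 0 := by
      intro r hr
      rw [hqy, Submodule.mem_colon_singleton] at hr
      exact hr
    obtain ⟨x, hxm, hx⟩ : ∃ x ∈ maximalIdeal R, x ∈ nonZeroDivisors R := by
      by_contra! hcon
      have hpos := Ideal.bot_lt_annihilator_of_disjoint_nonZeroDivisors
        (I := maximalIdeal R) (Set.disjoint_left.mpr hcon)
      obtain ⟨s, hs, hs0⟩ := SetLike.exists_of_lt hpos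
      rw [Submodule.mem_annihilator] at hs
      have hms : ∀ r ∈ maximalIdeal R, r * s = 0 := fun r hr => by
        rw [mul_comm]; exact hs r hr
      have hs0 : s ≠ 0 := hs0
      have := injective_self_of_mul_eq_zero hs0 hms n hn
      obtain ⟨k, hk⟩ := exists_maximalIdeal_pow_eq_bot
        (fun K w hw => exists_mul_eq_zero_of_injective_self (R := R) hs0 hms hw)
      rw [ringKrullDim_eq_zero_of_maximalIdeal_pow_eq_bot hk] at hd
      norm_cast at hd
    have hxspan : Ideal.span {x} ≠ ⊤ := by
      rw [Ne, Ideal.span_singleton_eq_top]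
      exact hxm
    have : Nontrivial (R ⧸ Ideal.span {x}) := Ideal.Quotient.nontrivial_iff.mpr hxspan
    have : IsLocalRing (R ⧸ Ideal.span {x}) :=
      IsLocalRing.of_surjective' (Ideal.Quotient.mk _) Ideal.Quotient.mk_surjective
    have hdim := ringKrullDim_quotient_span_singleton_succ_eq_ringKrullDim_of_mem_nonZeroDivisors
      hx hxm
    have hinj := hasInjectiveDimensionLE_quotient_span_singleton hx n hn
    obtain ⟨e, he⟩ := exists_ringKrullDim_eq_natCast (R ⧸ Ideal.span {x})
    have hed : e = d := by
      rw [he, hd] at hdim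
      norm_cast at hdim
      lia
    subst hed
    obtain ⟨w, hqw, hwx⟩ : ∃ w, (∀ r ∈ q, r * w = 0) ∧ w ∉ Ideal.span {x} := by
      by_contra! hcon
      have hK : Submodule.annihilator q = ⊥ := by
        apply Submodule.eq_bot_of_le_smul_of_le_jacobson_bot (maximalIdeal R) _
          (IsNoetherian.noetherian _)
        · intro w hw
          rw [Submodule.mem_annihilator] at hw
          have hw' : ∀ r ∈ q, r * w = 0 := fun r hr => by rw [mul_comm]; exact hw r hr
          obtain ⟨v, rfl⟩ := Ideal.mem_span_singleton'.mp (hcon w hw')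
          rw [mul_comm]
          refine Ideal.mul_mem_mul hxm ?_
          rw [Submodule.mem_annihilator]
          intro r hr
          apply mem_nonZeroDivisors_iff_left.mp hx
          rw [← hw' r hr, smul_eq_mul]
          ring
        · rw [jacobson_eq_maximalIdeal _ bot_ne_top]
      have : y ∈ Submodule.annihilator q := by
        rw [Submodule.mem_annihilator]
        intro r hr
        rw [smul_eq_mul, mul_comm]
        exact hqy0 r hr
      rw [hK] at this
      exact hy0 this
    have hxq : x ∉ q := fun hxq => hy0 (mem_nonZeroDivisors_iff_left.mp hx y (hqy0 x hxq))
    have key := ih (R ⧸ Ideal.span {x}) n hinj he (q.map (Ideal.Quotient.mk _))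
      (Ideal.Quotient.mk _ w) (fun h => hwx (Ideal.Quotient.eq_zero_iff_mem.mp h)) (by
        intro r hr
        obtain ⟨t, ht, rfl⟩ := (Ideal.mem_map_iff_of_surjective _
          Ideal.Quotient.mk_surjective).mp hr
        rw [← map_mul, hqw t ht, map_zero])
    have hxq' : Ideal.Quotient.mk q x ∈ nonZeroDivisors (R ⧸ q) := by
      apply mem_nonZeroDivisors_of_ne_zero
      rwa [Ne, Ideal.Quotient.eq_zero_iff_mem]
    have h2 := ringKrullDim_quotient_succ_le_of_nonZeroDivisor hxq'
    have h3 : ringKrullDim ((R ⧸ Ideal.span {x}) ⧸ q.map (Ideal.Quotient.mk (Ideal.span {x}))) =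
        ringKrullDim ((R ⧸ q) ⧸ Ideal.span {Ideal.Quotient.mk q x}) := by
      have h4 : Ideal.span {Ideal.Quotient.mk q x} =
          (Ideal.span {x}).map (Ideal.Quotient.mk q) := by
        rw [Ideal.map_span, Set.image_singleton]
      rw [h4]
      exact ringKrullDim_eq_of_ringEquiv (DoubleQuot.quotQuotEquivComm _ _)
    rw [← hdim]
    refine le_trans ?_ h2
    rw [← h3]
    gcongr

/-- A system of parameters of a local ring of finite self-injective dimension starts with a
nonzerodivisor. -/
theorem mem_nonZeroDivisors_of_isSystemOfParameters {R : Type u} [CommRing R] [IsLocalRing R]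
    [IsNoetherianRing R] {n c : ℕ} (hn : HasInjectiveDimensionLE (ModuleCat.of R R) n)
    (hd : ringKrullDim R = (c + 1 : ℕ)) (a : R) (b : Fin c → R)
    (hab : maximalIdeal R ≤ (Ideal.span {a} ⊔ Ideal.span (Set.range b)).radical)
    (hle : Set.range b ⊆ maximalIdeal R) :
    a ∈ nonZeroDivisors R := by
  rw [mem_nonZeroDivisors_iff_left]
  intro z hz
  by_contra hz0
  have key := ringKrullDim_le_quotient_of_mul_eq_zero _ R n hn hd (Ideal.span {a}) z hz0 (by
    intro r hr
    obtain ⟨s, rfl⟩ := Ideal.mem_span_singleton'.mp hr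
    rw [mul_assoc, hz, mul_zero])
  by_cases hau : IsUnit a
  · exact hz0 (hau.mul_right_eq_zero.mp hz)
  have hS : Nontrivial (R ⧸ Ideal.span {a}) :=
    Ideal.Quotient.nontrivial_iff.mpr (by rwa [Ne, Ideal.span_singleton_eq_top])
  have : IsLocalRing (R ⧸ Ideal.span {a}) :=
    IsLocalRing.of_surjective' (Ideal.Quotient.mk _) Ideal.Quotient.mk_surjective
  let s : Set (R ⧸ Ideal.span {a}) := Ideal.Quotient.mk _ '' Set.range b
  have hs : s ⊆ Ring.jacobson (R ⧸ Ideal.span {a}) := by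
    rw [ringJacobson_eq_maximalIdeal]
    rintro _ ⟨r, hr, rfl⟩
    have := Function.Surjective.isLocalHom (Ideal.Quotient.mk (Ideal.span {a}))
      Ideal.Quotient.mk_surjective
    exact map_nonunit (Ideal.Quotient.mk (Ideal.span {a})) r (hle hr)
  have h1 := ringKrullDim_le_ringKrullDim_quotient_add_encard s hs
  have h2 : s.encard ≤ c := by
    refine (Set.encard_image_le _ _).trans ?_
    rw [← Set.image_univ]
    refine (Set.encard_image_le _ _).trans ?_
    simp
  have h3 : ringKrullDim ((R ⧸ Ideal.span {a}) ⧸ Ideal.span s) ≤ 0 := by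
    have h4 : Ideal.span s =
        (Ideal.span (Set.range b)).map (Ideal.Quotient.mk (Ideal.span {a})) := by
      rw [Ideal.map_span]
    rw [h4, ringKrullDim_eq_of_ringEquiv (DoubleQuot.quotQuotEquivQuotSup _ _)]
    have : Nontrivial (R ⧸ Ideal.span {a} ⊔ Ideal.span (Set.range b)) :=
      Ideal.Quotient.nontrivial_iff.mpr (fun h => by
        have : Ideal.span {a} ⊔ Ideal.span (Set.range b) ≤ maximalIdeal R :=
          sup_le (by rw [Ideal.span_le]; simpa using hau) (Ideal.span_le.mpr hle)
        exact (maximalIdeal.isMaximal R).ne_top (top_le_iff.mp (h ▸ this)))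
    refine (ringKrullDimZero_iff_ringKrullDim_eq_zero.mp ?_).le
    rw [Ring.krullDimLE_zero_iff]
    intro q hq
    have hq' : (q.comap (Ideal.Quotient.mk _)).IsPrime := inferInstance
    have : q.comap (Ideal.Quotient.mk _) = maximalIdeal R := by
      apply le_antisymm (le_maximalIdeal hq'.ne_top)
      refine hab.trans (hq'.radical_le_iff.mpr ?_)
      intro r hr
      rw [Ideal.mem_comap, Ideal.Quotient.eq_zero_iff_mem.mpr hr]
      exact q.zero_mem
    have hmap := Ideal.map_comap_of_surjective _ Ideal.Quotient.mk_surjective q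
    rw [this] at hmap
    rcases Ideal.map_eq_top_or_isMaximal_of_surjective _
      (Ideal.Quotient.mk_surjective (I := Ideal.span {a} ⊔ Ideal.span (Set.range b)))
      (maximalIdeal.isMaximal R) with h | h
    · exact absurd (hmap.symm.trans h) hq.ne_top
    · rwa [hmap] at h
  have h5 : ((c + 1 : ℕ) : WithBot ℕ∞) ≤ (0 : WithBot ℕ∞) + ((c : ℕ∞) : WithBot ℕ∞) := by
    rw [← hd]
    refine key.trans (h1.trans (add_le_add h3 ?_))
    exact_mod_cast h2
  rw [zero_add] at h5
  norm_cast at h5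
  lia

end Dimension

section Parameters

open CategoryTheory IsLocalRing

variable {R : Type u} [CommRing R]

attribute [local instance] RingHomInvPair.of_ringEquiv in
theorem RingEquiv.hasInjectiveDimensionLE {S : Type u} [CommRing S] (e : R ≃+* S) (n : ℕ)
    (h : HasInjectiveDimensionLE (ModuleCat.of R R) n) :
    HasInjectiveDimensionLE (ModuleCat.of S S) n :=
  (ModuleCat.hasInjectiveDimensionLE_iff_of_semiLinearEquiv e e.toSemilinearEquiv n).mp h

/-- `R ⧸ J` is nontrivial of Krull dimension `c` and has finite self-injective dimension. -/
structure Ideal.HasGorensteinQuotient (J : Ideal R) (c : ℕ) : Prop where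
  ne_top : J ≠ ⊤
  ringKrullDim_eq : ringKrullDim (R ⧸ J) = c
  exists_le : ∃ n, HasInjectiveDimensionLE (ModuleCat.of (R ⧸ J) (R ⧸ J)) n

variable [IsLocalRing R]

theorem Ideal.hasGorensteinQuotient_bot {n d : ℕ}
    (hn : HasInjectiveDimensionLE (ModuleCat.of R R) n) (hd : ringKrullDim R = d) :
    (⊥ : Ideal R).HasGorensteinQuotient d where
  ne_top := bot_ne_top
  ringKrullDim_eq := by
    rw [ringKrullDim_eq_of_ringEquiv (RingEquiv.quotientBot R), hd]
  exists_le := ⟨n, (RingEquiv.quotientBot R).symm.hasInjectiveDimensionLE n hn⟩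

variable [IsNoetherianRing R]

theorem Ideal.HasGorensteinQuotient.sup_span_singleton {J : Ideal R} {c : ℕ}
    (hJ : J.HasGorensteinQuotient (c + 1)) {a : R} {b : Fin c → R} (ha : a ∈ maximalIdeal R)
    (hb : Set.range b ⊆ maximalIdeal R)
    (hab : maximalIdeal R ≤ (J ⊔ (Ideal.span {a} ⊔ Ideal.span (Set.range b))).radical) :
    (∀ x, x * a ∈ J → x ∈ J) ∧ (J ⊔ Ideal.span {a}).HasGorensteinQuotient c := by
  have : Nontrivial (R ⧸ J) := Ideal.Quotient.nontrivial_iff.mpr hJ.ne_top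
  have hloc : IsLocalRing (R ⧸ J) :=
    IsLocalRing.of_surjective' (Ideal.Quotient.mk _) Ideal.Quotient.mk_surjective
  have hlh := Function.Surjective.isLocalHom (Ideal.Quotient.mk J) Ideal.Quotient.mk_surjective
  obtain ⟨n, hn⟩ := hJ.exists_le
  have hmap : (Ideal.span {a}).map (Ideal.Quotient.mk J) = Ideal.span {Ideal.Quotient.mk J a} := by
    rw [Ideal.map_span, Set.image_singleton]
  have ha' : Ideal.Quotient.mk J a ∈ maximalIdeal (R ⧸ J) := map_nonunit (Ideal.Quotient.mk J) a ha
  have hreg : Ideal.Quotient.mk J a ∈ nonZeroDivisors (R ⧸ J) := by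
    apply mem_nonZeroDivisors_of_isSystemOfParameters hn hJ.ringKrullDim_eq _
      (fun i => Ideal.Quotient.mk J (b i))
    · intro r hr
      obtain ⟨r, rfl⟩ := Ideal.Quotient.mk_surjective r
      have hrm : r ∈ maximalIdeal R := by
        by_contra h
        have hu : IsUnit r := by simpa using h
        exact hr (hu.map (Ideal.Quotient.mk J))
      obtain ⟨k, hk⟩ := hab hrm
      refine ⟨k, ?_⟩
      have h1 := Ideal.mem_map_of_mem (Ideal.Quotient.mk J) hk
      rw [Ideal.map_sup, Ideal.map_sup, Ideal.map_quotient_self, bot_sup_eq, hmap, Ideal.map_span,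
        map_pow, ← Set.range_comp] at h1
      exact h1
    · rintro _ ⟨i, rfl⟩
      exact map_nonunit (Ideal.Quotient.mk J) (b i) (hb ⟨i, rfl⟩)
  refine ⟨fun x hx => ?_, ?_, ?_, n, ?_⟩
  · rw [← Ideal.Quotient.eq_zero_iff_mem] at hx ⊢
    rw [map_mul] at hx
    exact mem_nonZeroDivisors_iff_right.mp hreg _ hx
  · intro h
    have : J ⊔ Ideal.span {a} ≤ maximalIdeal R :=
      sup_le (le_maximalIdeal hJ.ne_top) ((Ideal.span_singleton_le_iff_mem _).mpr ha)
    exact (maximalIdeal.isMaximal R).ne_top (top_le_iff.mp (h ▸ this))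
  · have hd := ringKrullDim_quotient_span_singleton_succ_eq_ringKrullDim_of_mem_nonZeroDivisors
      hreg ha'
    rw [← hmap, ringKrullDim_eq_of_ringEquiv (DoubleQuot.quotQuotEquivQuotSup _ _),
      hJ.ringKrullDim_eq] at hd
    have : IsLocalRing (R ⧸ J ⊔ Ideal.span {a}) := by
      have : Nontrivial (R ⧸ J ⊔ Ideal.span {a}) := by
        rw [Ideal.Quotient.nontrivial_iff]
        intro h
        have : J ⊔ Ideal.span {a} ≤ maximalIdeal R :=
          sup_le (le_maximalIdeal hJ.ne_top) ((Ideal.span_singleton_le_iff_mem _).mpr ha)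
        exact (maximalIdeal.isMaximal R).ne_top (top_le_iff.mp (h ▸ this))
      exact IsLocalRing.of_surjective' (Ideal.Quotient.mk _) Ideal.Quotient.mk_surjective
    obtain ⟨e, he⟩ := exists_ringKrullDim_eq_natCast (R ⧸ J ⊔ Ideal.span {a})
    rw [he] at hd ⊢
    norm_cast at hd
    rw [Nat.add_right_cancel hd]
  · have h1 := hasInjectiveDimensionLE_quotient_span_singleton hreg n hn
    have e : ((R ⧸ J) ⧸ (R ⧸ J) ∙ Ideal.Quotient.mk J a) ≃+* R ⧸ J ⊔ Ideal.span {a} :=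
      (Ideal.quotEquivOfEq hmap.symm).trans (DoubleQuot.quotQuotEquivQuotSup _ _)
    exact e.hasInjectiveDimensionLE n h1

/-- Killing an initial part of a system of parameters. -/
theorem Ideal.hasGorensteinQuotient_span {n : ℕ}
    (hn : HasInjectiveDimensionLE (ModuleCat.of R R) n) {e : ℕ} : ∀ {c : ℕ} (a : Fin e → R)
    (b : Fin c → R), ringKrullDim R = (e + c : ℕ) → Set.range a ⊆ maximalIdeal R →
    Set.range b ⊆ maximalIdeal R →
    maximalIdeal R ≤ (Ideal.span (Set.range a) ⊔ Ideal.span (Set.range b)).radical →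
    (Ideal.span (Set.range a)).HasGorensteinQuotient c := by
  induction e with
  | zero =>
    intro c a b hd _ _ _
    rw [Set.range_eq_empty, Ideal.span_empty]
    exact Ideal.hasGorensteinQuotient_bot hn (by simpa using hd)
  | succ e ih =>
    intro c a b hd ha hb hab
    have hspan : Ideal.span (Set.range a) =
        Ideal.span (Set.range (Fin.init a)) ⊔ Ideal.span {a (Fin.last e)} := by
      conv_lhs => rw [← Fin.snoc_init_self a, Fin.range_snoc, Set.insert_eq, Ideal.span_union,
        sup_comm]
    have hspan' : Ideal.span (Set.range (Fin.cons (a (Fin.last e)) b : Fin (c + 1) → R)) =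
        Ideal.span {a (Fin.last e)} ⊔ Ideal.span (Set.range b) := by
      rw [Fin.range_cons, Set.insert_eq, Ideal.span_union]
    have hlast : a (Fin.last e) ∈ maximalIdeal R := ha ⟨_, rfl⟩
    rw [hspan, sup_assoc] at hab
    have h1 := ih (c := c + 1) (Fin.init a) (Fin.cons (a (Fin.last e)) b) (by rw [hd]; congr 1; lia)
      (by rintro _ ⟨i, rfl⟩; exact ha ⟨_, rfl⟩)
      (by rw [Fin.range_cons]; exact Set.insert_subset hlast hb) (by rwa [hspan'])
    rw [hspan]
    exact (h1.sup_span_singleton hlast hb hab).2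

theorem Ideal.HasGorensteinQuotient.exists_mul_notMem {Q : Ideal R}
    (hQ : Q.HasGorensteinQuotient 0) {K : Ideal R} (hQK : Q ≤ K) {w : R} (hw : w ∉ K) :
    ∃ r, (∀ k ∈ K, r * k ∈ Q) ∧ r * w ∉ Q := by
  have : Nontrivial (R ⧸ Q) := Ideal.Quotient.nontrivial_iff.mpr hQ.ne_top
  have hloc : IsLocalRing (R ⧸ Q) :=
    IsLocalRing.of_surjective' (Ideal.Quotient.mk _) Ideal.Quotient.mk_surjective
  obtain ⟨n, hn⟩ := hQ.exists_le
  have hdim : Ring.KrullDimLE 0 (R ⧸ Q) := by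
    rw [ringKrullDimZero_iff_ringKrullDim_eq_zero, hQ.ringKrullDim_eq]
    rfl
  have hpos := Ideal.bot_lt_annihilator_of_disjoint_nonZeroDivisors
    (I := maximalIdeal (R ⧸ Q)) (Set.disjoint_left.mpr fun x hx hx' => by
      have hx : IsNilpotent x := Ring.KrullDimLE.isNilpotent_iff_mem_maximalIdeal.mpr hx
      obtain ⟨k, hk⟩ := hx
      exact zero_ne_one (α := R ⧸ Q) (mem_nonZeroDivisors_iff_left.mp (pow_mem hx' k) 1 (by
        rw [hk, zero_mul])).symm)
  obtain ⟨s, hs, hs0⟩ := SetLike.exists_of_lt hpos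
  rw [Submodule.mem_annihilator] at hs
  have hms : ∀ r ∈ maximalIdeal (R ⧸ Q), r * s = 0 := fun r hr => by
    rw [mul_comm]; exact hs r hr
  have hs0 : s ≠ 0 := hs0
  have := injective_self_of_mul_eq_zero hs0 hms n hn
  obtain ⟨r, hr, hrw⟩ := exists_mul_eq_zero_of_injective_self (R := R ⧸ Q) hs0 hms
    (K := K.map (Ideal.Quotient.mk Q)) (w := Ideal.Quotient.mk Q w) (fun h => hw (by
      have h : w ∈ (K.map (Ideal.Quotient.mk Q)).comap (Ideal.Quotient.mk Q) := h
      rwa [Ideal.comap_map_of_surjective' _ Ideal.Quotient.mk_surjective, Ideal.mk_ker,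
        sup_eq_left.mpr hQK] at h))
  obtain ⟨r, rfl⟩ := Ideal.Quotient.mk_surjective r
  refine ⟨r, fun k hk => ?_, fun h => hrw ?_⟩
  · rw [← Ideal.Quotient.eq_zero_iff_mem, map_mul]
    exact hr _ (Ideal.mem_map_of_mem _ hk)
  · rw [← map_mul]
    exact Ideal.Quotient.eq_zero_iff_mem.mpr h

end Parameters

section QuasiSocle

open IsLocalRing

variable {R : Type u} [CommRing R] [IsLocalRing R]

/-- The double colon property of `Q`: `Q : (Q : K) = K` for all ideals `K` containing `Q`. -/
def Ideal.IsDualizing (Q : Ideal R) : Prop :=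
  ∀ ⦃K : Ideal R⦄, Q ≤ K → ∀ ⦃w : R⦄, w ∉ K → ∃ r, (∀ k ∈ K, r * k ∈ Q) ∧ r * w ∉ Q

theorem Ideal.IsDualizing.exists_sub_mul_mem {Q : Ideal R} (hQ : Q.IsDualizing) {s t : R}
    (hs : s ∉ Q) (ht : ∀ r ∈ maximalIdeal R, r * t ∈ Q) : ∃ c, t - c * s ∈ Q := by
  by_cases h : t ∈ Q ⊔ Ideal.span {s}
  · obtain ⟨q, hq, y, hy, rfl⟩ := Submodule.mem_sup.mp h
    obtain ⟨c, rfl⟩ := Ideal.mem_span_singleton'.mp hy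
    exact ⟨c, by rwa [add_sub_cancel_right]⟩
  · obtain ⟨r, hr, hrt⟩ := hQ le_sup_left h
    have hu : IsUnit r := by
      by_contra hr'
      exact hrt (ht r hr')
    have := hr s (Ideal.mem_sup_right (Ideal.mem_span_singleton_self s))
    exact absurd ((Ideal.unit_mul_mem_iff_mem Q hu).mp this) hs

theorem Ideal.IsDualizing.exists_maximalIdeal_le {K : Ideal R} (hK : K.IsDualizing)
    (hm : maximalIdeal R ^ 2 ≤ K) : ∃ w ∈ maximalIdeal R, maximalIdeal R ≤ K ⊔ Ideal.span {w} := by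
  by_cases h : maximalIdeal R ≤ K
  · exact ⟨0, zero_mem _, h.trans le_sup_left⟩
  · obtain ⟨s, hs, hsK⟩ := SetLike.not_le_iff_exists.mp h
    refine ⟨s, hs, fun t ht => ?_⟩
    obtain ⟨c, hc⟩ := hK.exists_sub_mul_mem hsK (t := t) (fun r hr => hm (by
      rw [pow_two]; exact Ideal.mul_mem_mul hr ht))
    rw [← sub_add_cancel t (c * s)]
    exact Ideal.add_mem _ (Ideal.mem_sup_left hc)
      (Ideal.mem_sup_right (Ideal.mul_mem_left _ _ (Ideal.mem_span_singleton_self s)))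

/-- If products `y * x ∈ Q` with `y ∈ 𝔪` and `x ∈ Q : 𝔪²` always lie in `𝔪 Q`, then
`𝔪² (Q : 𝔪²) ⊆ 𝔪² Q`. -/
theorem mul_mem_of_forall_mul_mem {Q : Ideal R} (hQ : Q.IsDualizing)
    (hv : ∀ z ∈ maximalIdeal R, ∃ w ∈ maximalIdeal R, w ∉ maximalIdeal R ^ 2 ⊔ Q ⊔ Ideal.span {z})
    (hmul : ∀ y ∈ maximalIdeal R, ∀ x, (∀ t ∈ maximalIdeal R ^ 2, x * t ∈ Q) → y * x ∈ Q →
      y * x ∈ maximalIdeal R * Q)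
    {x : R} (hx : ∀ t ∈ maximalIdeal R ^ 2, x * t ∈ Q) {t : R} (ht : t ∈ maximalIdeal R ^ 2) :
    t * x ∈ maximalIdeal R ^ 2 * Q := by
  have hpair : ∀ z ∈ maximalIdeal R, ∃ y ∈ maximalIdeal R, ∃ x,
      (∀ t ∈ maximalIdeal R ^ 2, x * t ∈ Q) ∧
      y * x ∉ Q ∧ z * x ∈ Q := by
    intro z hz
    obtain ⟨w, hw, hwz⟩ := hv z hz
    obtain ⟨r, hr, hrw⟩ := hQ (le_sup_right.trans le_sup_left) hwz
    exact ⟨w, hw, r, fun t ht => hr t (Ideal.mem_sup_left (Ideal.mem_sup_left ht)),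
      by rwa [mul_comm], by
        rw [mul_comm]; exact hr z (Ideal.mem_sup_right (Ideal.mem_span_singleton_self z))⟩
  have hsoc : ∀ y ∈ maximalIdeal R, ∀ x, (∀ t ∈ maximalIdeal R ^ 2, x * t ∈ Q) →
      ∀ r ∈ maximalIdeal R, r * (y * x) ∈ Q := by
    intro y hy x hx r hr
    rw [← mul_assoc, mul_comm]
    exact hx _ (by rw [pow_two]; exact Ideal.mul_mem_mul hr hy)
  have hsub : ∀ {x x' : R}, (∀ t ∈ maximalIdeal R ^ 2, x * t ∈ Q) →
      (∀ t ∈ maximalIdeal R ^ 2, x' * t ∈ Q) → ∀ c : R,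
      ∀ t ∈ maximalIdeal R ^ 2, (x - c * x') * t ∈ Q := by
    intro x x' hx hx' c t ht
    rw [sub_mul, mul_assoc]
    exact Q.sub_mem (hx t ht) (Q.mul_mem_left _ (hx' t ht))
  have hm₂ : ∀ a ∈ maximalIdeal R, ∀ b ∈ maximalIdeal R * Q, a * b ∈ maximalIdeal R ^ 2 * Q := by
    intro a ha b hb
    rw [pow_two, mul_assoc]
    exact Ideal.mul_mem_mul ha hb
  obtain ⟨y₀, hy₀, x₀, hx₀, hs, -⟩ := hpair 0 (zero_mem _)
  -- everything in `𝔪 (Q : 𝔪²)` is a multiple of `y₀ * x₀` modulo `𝔪 Q`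
  have h₁ : ∀ y ∈ maximalIdeal R, ∃ c, y * x₀ - c * (y₀ * x₀) ∈ maximalIdeal R * Q := by
    intro y hy
    obtain ⟨c, hc⟩ := hQ.exists_sub_mul_mem hs (hsoc y hy x₀ hx₀)
    have he : y * x₀ - c * (y₀ * x₀) = (y - c * y₀) * x₀ := by ring
    rw [he] at hc
    exact ⟨c, he ▸ hmul _ (Ideal.sub_mem _ hy (Ideal.mul_mem_left _ _ hy₀)) _ hx₀ hc⟩
  have h₂ : ∀ x, (∀ t ∈ maximalIdeal R ^ 2, x * t ∈ Q) →
      ∃ c, y₀ * x - c * (y₀ * x₀) ∈ maximalIdeal R * Q := by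
    intro x hx
    obtain ⟨c, hc⟩ := hQ.exists_sub_mul_mem hs (hsoc y₀ hy₀ x hx)
    have he : y₀ * x - c * (y₀ * x₀) = y₀ * (x - c * x₀) := by ring
    rw [he] at hc
    exact ⟨c, he ▸ hmul _ hy₀ _ (hsub hx hx₀ c) hc⟩
  have h₃ : ∀ y ∈ maximalIdeal R, ∀ x, (∀ t ∈ maximalIdeal R ^ 2, x * t ∈ Q) →
      ∃ c, y * x - c * (y₀ * x₀) ∈ maximalIdeal R * Q := by
    intro y hy x hx
    by_cases hyx : y₀ * x ∈ Q
    · by_cases hyx' : y * x₀ ∈ Q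
      · obtain ⟨c, hc⟩ := hQ.exists_sub_mul_mem hs (hsoc y hy x hx)
        refine ⟨c, ?_⟩
        have hp₁ := hmul y₀ hy₀ x hx hyx
        have hp₂ := hmul y hy x₀ hx₀ hyx'
        have he : (y + y₀) * (x - c * x₀) =
            (y * x - c * (y₀ * x₀)) + y₀ * x - c * (y * x₀) := by ring
        have h := hmul (y + y₀) (Ideal.add_mem _ hy hy₀) (x - c * x₀) (hsub hx hx₀ c) (by
          rw [he]
          exact Q.sub_mem (Q.add_mem hc hyx) (Q.mul_mem_left _ hyx'))
        have he' : y * x - c * (y₀ * x₀) =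
            (y + y₀) * (x - c * x₀) - y₀ * x + c * (y * x₀) := by ring
        rw [he']
        exact Ideal.add_mem _ (Ideal.sub_mem _ h hp₁) (Ideal.mul_mem_left _ _ hp₂)
      · obtain ⟨c, hc⟩ := hQ.exists_sub_mul_mem hyx' (hsoc y hy x hx)
        obtain ⟨d, hd⟩ := h₁ y hy
        have he : y * x - c * (y * x₀) = y * (x - c * x₀) := by ring
        rw [he] at hc
        have h := hmul y hy _ (hsub hx hx₀ c) hc
        refine ⟨c * d, ?_⟩
        have he' : y * x - c * d * (y₀ * x₀) =
            y * (x - c * x₀) + c * (y * x₀ - d * (y₀ * x₀)) := by ring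
        rw [he']
        exact Ideal.add_mem _ h (Ideal.mul_mem_left _ _ hd)
    · obtain ⟨c, hc⟩ := hQ.exists_sub_mul_mem hyx (hsoc y hy x hx)
      obtain ⟨d, hd⟩ := h₂ x hx
      have he : y * x - c * (y₀ * x) = (y - c * y₀) * x := by ring
      rw [he] at hc
      have h := hmul _ (Ideal.sub_mem _ hy (Ideal.mul_mem_left _ c hy₀)) x hx hc
      refine ⟨c * d, ?_⟩
      have he' : y * x - c * d * (y₀ * x₀) =
          (y - c * y₀) * x + c * (y₀ * x - d * (y₀ * x₀)) := by ring
      rw [he']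
      exact Ideal.add_mem _ h (Ideal.mul_mem_left _ _ hd)
  have h₄ : ∀ z ∈ maximalIdeal R, z * (y₀ * x₀) ∈ maximalIdeal R ^ 2 * Q := by
    intro z hz
    obtain ⟨y, hy, x, hx, hyx, hzx⟩ := hpair z hz
    obtain ⟨c, hc⟩ := h₃ y hy x hx
    have hu : IsUnit c := by
      by_contra hcm
      apply hyx
      rw [← sub_add_cancel (y * x) (c * (y₀ * x₀))]
      exact Q.add_mem (Ideal.mul_le_right hc)
        (hsoc y₀ hy₀ x₀ hx₀ c ((mem_maximalIdeal c).mpr hcm))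
    rw [← Ideal.unit_mul_mem_iff_mem _ hu]
    have he : c * (z * (y₀ * x₀)) = y * (z * x) - z * (y * x - c * (y₀ * x₀)) := by ring
    rw [he]
    exact Ideal.sub_mem _ (hm₂ y hy _ (hmul z hz x hx hzx)) (hm₂ z hz _ hc)
  rw [pow_two] at ht
  induction ht using Submodule.mul_induction_on' with
  | mem_mul_mem z hz y hy =>
    obtain ⟨c, hc⟩ := h₃ y hy x hx
    have he : z * y * x = c * (z * (y₀ * x₀)) + z * (y * x - c * (y₀ * x₀)) := by ring
    rw [he]
    exact Ideal.add_mem _ (Ideal.mul_mem_left _ _ (h₄ z hz)) (hm₂ z hz _ hc)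
  | add a _ b _ ha hb =>
    rw [add_mul]
    exact Ideal.add_mem _ ha hb

/-- If `y * x` is a member of a system of parameters generating `Q`, `x ∈ Q : 𝔪²`, then
`𝔪²` lies in the parameter ideal obtained by replacing `y * x` by `y`. -/
theorem maximalIdeal_sq_le_of_mul_mem {q : Ideal R} {x y : R}
    (hreg : ∀ r, r * (y * x) ∈ q → r ∈ q)
    (hx : ∀ t ∈ maximalIdeal R ^ 2, x * t ∈ q ⊔ Ideal.span {y * x}) :
    maximalIdeal R ^ 2 ≤ q ⊔ Ideal.span {y} := by
  intro t ht
  obtain ⟨a, ha, b, hb, hab⟩ := Submodule.mem_sup.mp (hx t ht)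
  obtain ⟨c, rfl⟩ := Ideal.mem_span_singleton'.mp hb
  have h : t - c * y ∈ q := by
    apply hreg
    have : (t - c * y) * (y * x) = y * a := by
      linear_combination (-y) * hab
    rw [this]
    exact q.mul_mem_left _ ha
  rw [← sub_add_cancel t (c * y)]
  exact Ideal.add_mem _ (Ideal.mem_sup_left h)
    (Ideal.mem_sup_right (Ideal.mul_mem_left _ _ (Ideal.mem_span_singleton_self y)))

end QuasiSocle

section Integrality

theorem isIntegralOverIdeal_of_mul_mem {R : Type u} [CommRing R] {Q M : Ideal R} (hM : M.FG)
    {x : R} (h : ∀ t ∈ M, t * x ∈ M * Q) (hann : ∀ z, (∀ t ∈ M, t * z = 0) → z = 0) :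
    IsIntegralOverIdeal Q x := by
  have : Module.Finite R M := Module.Finite.iff_fg.mpr hM
  obtain ⟨p, hp, -, hcoeff, heval⟩ :=
    LinearMap.exists_monic_and_natDegree_eq_and_coeff_mem_pow_and_aeval_eq_zero R
      (algebraMap R (Module.End R M) x) Q (by
        rintro _ ⟨⟨t, ht⟩, rfl⟩
        have h1 := h t ht
        rw [mul_comm M Q, ← smul_eq_mul, ← Submodule.map_subtype_top M,
          ← Submodule.map_smul''] at h1
        obtain ⟨a, ha, hat⟩ := h1
        have : algebraMap R (Module.End R M) x ⟨t, ht⟩ = a := by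
          apply Subtype.ext
          change x * t = M.subtype a
          rw [hat, mul_comm]
        rw [this]
        exact ha)
  refine ⟨p, hp, fun i _ => hcoeff i, hann _ fun t ht => ?_⟩
  rw [Polynomial.aeval_algebraMap_apply] at heval
  have h1 := congrArg Subtype.val (LinearMap.congr_fun heval ⟨t, ht⟩)
  have h1 : (Polynomial.aeval x p) * t = 0 := h1
  rwa [Polynomial.coe_aeval_eq_eval, mul_comm] at h1

end Integrality

section Length

open IsLocalRing

variable {R : Type u} [CommRing R]

theorem Ideal.length_quotient_le {I J : Ideal R} (h : I ≤ J) :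
    Module.length R (R ⧸ J) ≤ Module.length R (R ⧸ I) :=
  Module.length_le_of_surjective (Submodule.factor h) (Submodule.factor_surjective h)

theorem Ideal.length_quotient_le_add {I J : Ideal R} {a : R} (h : ∀ r ∈ I, r * a ∈ J) :
    Module.length R (R ⧸ J) ≤
      Module.length R (R ⧸ I) + Module.length R (R ⧸ J ⊔ Ideal.span {a}) := by
  let f : (R ⧸ I) →ₗ[R] (R ⧸ J) := Submodule.mapQ I J (LinearMap.toSpanSingleton R R a) h
  rw [Module.length_eq_add_of_exact (LinearMap.range f).subtype (LinearMap.range f).mkQ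
    (Submodule.subtype_injective _) (Submodule.mkQ_surjective _)
    (LinearMap.exact_subtype_mkQ _)]
  refine add_le_add (Module.length_le_of_surjective f.rangeRestrict f.surjective_rangeRestrict) ?_
  let g : (R ⧸ J ⊔ Ideal.span {a}) →ₗ[R] ((R ⧸ J) ⧸ LinearMap.range f) :=
    Submodule.liftQ (J ⊔ Ideal.span {a}) ((LinearMap.range f).mkQ ∘ₗ J.mkQ) (by
      refine sup_le (fun r hr => ?_) (Ideal.span_le.mpr (Set.singleton_subset_iff.mpr ?_))
      · rw [LinearMap.mem_ker, LinearMap.comp_apply]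
        have : J.mkQ r = 0 := (Submodule.Quotient.mk_eq_zero J).mpr hr
        rw [this, map_zero]
      · rw [SetLike.mem_coe, LinearMap.mem_ker, LinearMap.comp_apply, Submodule.mkQ_apply,
          Submodule.Quotient.mk_eq_zero]
        refine ⟨Submodule.Quotient.mk 1, ?_⟩
        change Submodule.Quotient.mk ((1 : R) • a) = _
        rw [one_smul]
        rfl)
  refine Module.length_le_of_surjective g fun y => ?_
  obtain ⟨y, rfl⟩ := Submodule.mkQ_surjective _ y
  obtain ⟨r, rfl⟩ := Submodule.mkQ_surjective _ y
  exact ⟨Submodule.Quotient.mk r, rfl⟩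

theorem Ideal.length_quotient_sup_span_pow_le (d : ℕ) : ∀ (a : Fin d → R) (J : Ideal R) (k : ℕ),
    Module.length R (R ⧸ J ⊔ Ideal.span (Set.range a) ^ k) ≤
      (k + d - 1).choose d * Module.length R (R ⧸ J ⊔ Ideal.span (Set.range a)) := by
  have htop : ∀ J : Ideal R, Module.length R (R ⧸ J ⊔ ⊤) = 0 := by
    intro J
    rw [Module.length_eq_zero_iff, Submodule.Quotient.subsingleton_iff]
    exact sup_top_eq J
  induction d with
  | zero =>
    intro a J k
    rw [Nat.choose_zero_right, Nat.cast_one, one_mul]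
    apply Ideal.length_quotient_le
    simp [Set.range_eq_empty]
  | succ d ih =>
    intro a J k
    induction k with
    | zero =>
      rw [pow_zero, Ideal.one_eq_top, htop]
      exact zero_le
    | succ k ihk =>
      set K := Ideal.span (Set.range a) with hK
      have ha : a (Fin.last d) ∈ K := Ideal.subset_span ⟨_, rfl⟩
      have hK' : Ideal.span (Set.range (Fin.init a)) ≤ K :=
        Ideal.span_mono (by rintro _ ⟨i, rfl⟩; exact ⟨_, rfl⟩)
      have hKs : K = Ideal.span {a (Fin.last d)} ⊔ Ideal.span (Set.range (Fin.init a)) := by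
        rw [hK]
        conv_lhs => rw [← Fin.snoc_init_self a, Fin.range_snoc, Set.insert_eq, Ideal.span_union]
      have h1 : Module.length R (R ⧸ J ⊔ K ^ (k + 1)) ≤ Module.length R (R ⧸ J ⊔ K ^ k) +
          Module.length R (R ⧸ J ⊔ K ^ (k + 1) ⊔ Ideal.span {a (Fin.last d)}) := by
        apply Ideal.length_quotient_le_add
        intro r hr
        obtain ⟨b, hb, c, hc, rfl⟩ := Submodule.mem_sup.mp hr
        rw [add_mul, pow_succ]
        exact Ideal.add_mem _ (Ideal.mem_sup_left (J.mul_mem_right _ hb))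
          (Ideal.mem_sup_right (Ideal.mul_mem_mul hc ha))
      have h2 : Module.length R (R ⧸ J ⊔ K ^ (k + 1) ⊔ Ideal.span {a (Fin.last d)}) ≤
          (k + 1 + d - 1).choose d * Module.length R (R ⧸ J ⊔ K) := by
        refine le_trans (Ideal.length_quotient_le ?_)
          ((ih (Fin.init a) (J ⊔ Ideal.span {a (Fin.last d)}) (k + 1)).trans ?_)
        · exact sup_le (sup_le (le_sup_left.trans le_sup_left) le_sup_right)
            ((Ideal.pow_right_mono hK' _).trans (le_sup_right.trans le_sup_left))
        · gcongr
          apply Ideal.length_quotient_le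
          rw [sup_assoc, ← hKs]
      refine h1.trans ((add_le_add ihk h2).trans ?_)
      rw [← add_mul]
      gcongr
      have : (k + 1 + (d + 1) - 1).choose (d + 1) =
          (k + (d + 1) - 1).choose (d + 1) + (k + 1 + d - 1).choose d := by
        have e1 : k + 1 + (d + 1) - 1 = (k + d) + 1 := by lia
        have e2 : k + (d + 1) - 1 = k + d := by lia
        have e3 : k + 1 + d - 1 = k + d := by lia
        rw [e1, e2, e3, Nat.choose_succ_succ, add_comm]
      rw [this]
      push_cast
      rfl

open Filter Topology ENNReal in
theorem ENNReal.limsup_factorial_mul_choose_le (d L : ℕ) {u : ℕ → ℕ∞}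
    (hu : ∀ k, u k ≤ (k + d - 1).choose d * L) :
    Filter.limsup
      (fun k : ℕ => (d.factorial : ENNReal) * ((u k : ℕ∞) : ENNReal) / (k : ENNReal) ^ d)
      Filter.atTop ≤ L := by
  have hlim : Tendsto (fun k : ℕ => (L : ENNReal) * (1 + d * (k : ENNReal)⁻¹) ^ d) atTop (𝓝 L) := by
    have h1 : Tendsto (fun k : ℕ => (d : ENNReal) * (k : ENNReal)⁻¹) atTop (𝓝 (d * 0)) :=
      ENNReal.Tendsto.const_mul ENNReal.tendsto_inv_nat_nhds_zero (Or.inr (natCast_ne_top d))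
    have h2 := ENNReal.Tendsto.pow (n := d) ((tendsto_const_nhds (x := (1 : ENNReal))).add h1)
    have h3 := ENNReal.Tendsto.const_mul (a := (L : ENNReal)) h2 (Or.inr (natCast_ne_top L))
    simpa using h3
  refine le_trans ?_ hlim.limsup_eq.le
  refine Filter.limsup_le_limsup ?_
  · filter_upwards [eventually_ge_atTop 1] with k hk
    have hk0 : (k : ENNReal) ≠ 0 := by exact_mod_cast (by lia : k ≠ 0)
    have hkt : (k : ENNReal) ≠ ⊤ := natCast_ne_top k
    have h1 : (u k : ENNReal) ≤ ((k + d - 1).choose d * L : ℕ) := by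
      have := ENat.toENNReal_le.mpr (hu k)
      refine this.trans_eq ?_
      push_cast
      rfl
    have h2 : d.factorial * ((k + d - 1).choose d * L) ≤ L * (k + d) ^ d := by
      rw [← mul_assoc, ← Nat.ascFactorial_eq_factorial_mul_choose', mul_comm]
      gcongr
      obtain ⟨k, rfl⟩ := Nat.exists_eq_add_of_le' hk
      exact (Nat.ascFactorial_le_pow_add k d).trans (by gcongr; lia)
    have h3 : (1 + d * (k : ENNReal)⁻¹) ^ d = ((k + d : ℕ) : ENNReal) ^ d / (k : ENNReal) ^ d := by
      rw [div_eq_mul_inv, ENNReal.inv_pow, ← mul_pow]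
      congr 1
      rw [Nat.cast_add, add_mul, ENNReal.mul_inv_cancel hk0 hkt]
    rw [h3, ← mul_div_assoc]
    refine ENNReal.div_le_div_right ?_ _
    calc (d.factorial : ENNReal) * (u k : ENNReal)
        ≤ d.factorial * ((k + d - 1).choose d * L : ℕ) := by gcongr
      _ ≤ _ := by exact_mod_cast h2

variable [IsLocalRing R]

theorem localMultiplicity_le_of_length_le {d L : ℕ} (hd : ringKrullDim R = d) (a : Fin d → R)
    (ha : Set.range a ⊆ maximalIdeal R)
    (hL : Module.length R (R ⧸ Ideal.span (Set.range a)) ≤ L) : localMultiplicity R ≤ L := by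
  unfold localMultiplicity
  have hd' : ((ringKrullDim R).unbotD 0).toNat = d := by rw [hd]; rfl
  rw [hd']
  apply ENNReal.limsup_factorial_mul_choose_le
  intro k
  refine le_trans ?_ (mul_le_mul_right hL _)
  have h := Ideal.length_quotient_sup_span_pow_le d a ⊥ k
  rw [bot_sup_eq, bot_sup_eq] at h
  exact (Ideal.length_quotient_le (Ideal.pow_right_mono (Ideal.span_le.mpr ha) k)).trans h

theorem length_quotient_le_two {K : Ideal R} {w : R} (hw : w ∈ maximalIdeal R)
    (hK : maximalIdeal R ^ 2 ≤ K) (hwK : maximalIdeal R ≤ K ⊔ Ideal.span {w}) :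
    Module.length R (R ⧸ K) ≤ 2 := by
  have h1 : Module.length R (R ⧸ maximalIdeal R) = 1 := by
    rw [Module.length_eq_one_iff, isSimpleModule_iff_isCoatom]
    exact (maximalIdeal.isMaximal R).out
  refine (Ideal.length_quotient_le_add (I := maximalIdeal R) (a := w) fun r hr => hK (by
    rw [pow_two]; exact Ideal.mul_mem_mul hr hw)).trans ?_
  refine (add_le_add_right (Ideal.length_quotient_le hwK) _).trans ?_
  rw [h1]
  norm_num

theorem embeddingDim_le [IsNoetherianRing R] {j : ℕ} {v : Fin j → R}
    (hv : maximalIdeal R = Ideal.span (Set.range v)) : embeddingDim R ≤ j := by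
  unfold embeddingDim
  rw [Module.length_eq_of_surjective (R := ResidueField R) (S := R)
    IsLocalRing.residue_surjective, Module.length_eq_finrank,
    ← spanFinrank_maximalIdeal_eq_finrank_cotangentSpace, hv]
  refine (ENat.natCast_le_natCast.mpr (Submodule.spanFinrank_span_le_ncard_of_finite
    (Set.finite_range v))).trans ?_
  norm_cast
  rw [← Set.image_univ]
  exact (Set.ncard_image_le Set.finite_univ).trans (by simp)

theorem embeddingDim_quotient_le [IsNoetherianRing R] {Q : Ideal R} [IsLocalRing (R ⧸ Q)]
    {j : ℕ} {v : Fin j → R} (hv : Set.range v ⊆ maximalIdeal R)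
    (h : maximalIdeal R ≤ maximalIdeal R ^ 2 ⊔ Q ⊔ Ideal.span (Set.range v)) :
    embeddingDim (R ⧸ Q) ≤ j := by
  have hlh := Function.Surjective.isLocalHom (Ideal.Quotient.mk Q) Ideal.Quotient.mk_surjective
  have hmap : (maximalIdeal R).map (Ideal.Quotient.mk Q) = maximalIdeal (R ⧸ Q) := by
    apply le_antisymm
    · rw [Ideal.map_le_iff_le_comap]
      exact fun r hr => map_nonunit (Ideal.Quotient.mk Q) r hr
    · intro r hr
      obtain ⟨r, rfl⟩ := Ideal.Quotient.mk_surjective r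
      refine Ideal.mem_map_of_mem _ ?_
      by_contra h
      have hu : IsUnit r := by simpa using h
      exact hr (hu.map (Ideal.Quotient.mk Q))
  apply embeddingDim_le (v := Ideal.Quotient.mk Q ∘ v)
  have hspan : Ideal.span (Set.range (Ideal.Quotient.mk Q ∘ v)) =
      (Ideal.span (Set.range v)).map (Ideal.Quotient.mk Q) := by
    rw [Ideal.map_span, Set.range_comp]
  rw [hspan]
  apply le_antisymm
  · apply Submodule.le_of_le_smul_of_le_jacobson_bot (IsNoetherian.noetherian _)
      (maximalIdeal_le_jacobson _)
    have := Ideal.map_mono (f := Ideal.Quotient.mk Q) h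
    rw [Ideal.map_sup, Ideal.map_sup, Ideal.map_quotient_self, sup_bot_eq, Ideal.map_pow,
      hmap] at this
    rwa [smul_eq_mul, ← pow_two, sup_comm]
  · rw [← hmap]
    exact Ideal.map_mono (Ideal.span_le.mpr hv)

end Length

section Main

open IsLocalRing

variable {R : Type u} [CommRing R] [IsLocalRing R]

/-- An element outside `𝔪 Q` can be exchanged against one of the given generators of `Q`. -/
theorem Ideal.exists_span_eq_sup_of_notMem_mul {c : ℕ} (a : Fin (c + 1) → R) {x : R}
    (hx : x ∈ Ideal.span (Set.range a)) (hxm : x ∉ maximalIdeal R * Ideal.span (Set.range a)) :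
    ∃ b : Fin c → R, Set.range b ⊆ Set.range a ∧
      Ideal.span (Set.range a) = Ideal.span (Set.range b) ⊔ Ideal.span {x} := by
  obtain ⟨r, hr⟩ := Ideal.mem_span_range_iff_exists_fun.mp hx
  obtain ⟨j, hj⟩ : ∃ j, IsUnit (r j) := by
    by_contra! h
    apply hxm
    rw [← hr]
    exact Ideal.sum_mem _ fun i _ => Ideal.mul_mem_mul (h i) (Ideal.subset_span ⟨i, rfl⟩)
  refine ⟨a ∘ j.succAbove, Set.range_comp_subset_range _ _, le_antisymm ?_ ?_⟩
  · rw [Ideal.span_le]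
    rintro _ ⟨i, rfl⟩
    have hmem : ∀ i : Fin c, a (j.succAbove i) ∈
        Ideal.span (Set.range (a ∘ j.succAbove)) ⊔ Ideal.span {x} :=
      fun i => Ideal.mem_sup_left (Ideal.subset_span ⟨i, rfl⟩)
    rcases Fin.eq_self_or_eq_succAbove j i with rfl | ⟨i, rfl⟩
    · rw [SetLike.mem_coe, ← Ideal.unit_mul_mem_iff_mem _ hj]
      rw [Fin.sum_univ_succAbove _ i] at hr
      rw [← eq_sub_iff_add_eq] at hr
      rw [hr]
      exact Ideal.sub_mem _ (Ideal.mem_sup_right (Ideal.mem_span_singleton_self x))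
        (Ideal.sum_mem _ fun i _ => Ideal.mul_mem_left _ _ (hmem i))
    · exact hmem i
  · exact sup_le (Ideal.span_mono (Set.range_comp_subset_range _ _))
      ((Ideal.span_singleton_le_iff_mem _).mpr hx)

end Main

theorem theorem2p7 (A : Type u) [CommRing A] [IsGorensteinLocalRing A]
    (hdim : 0 < ringKrullDim A)
    (Q : Ideal A) (hQ : IsParameterIdeal Q)
    (n : ℕ∞)
    (hn : n = @embeddingDim (A ⧸ Q) _ hQ.isLocalRing_quotient)
    (hn1 : 1 < n)
    (I : Ideal A)
    (hI : I = Q.colon ((IsLocalRing.maximalIdeal A ^ 2 : Ideal A) : Set A))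
    (hnot : ¬ ∀ x ∈ I, IsIntegralOverIdeal Q x) :
    localMultiplicity A ≤ 2 ∧ n = 2 := by
  have hlocQ := hQ.isLocalRing_quotient
  obtain ⟨N, hN⟩ := IsGorensteinLocalRing.exists_hasInjectiveDimensionLE (A := A)
  obtain ⟨d, a, hd, rfl, hrad⟩ := hQ
  obtain ⟨c, rfl⟩ : ∃ c, d = c + 1 := by
    refine Nat.exists_eq_succ_of_ne_zero ?_
    rintro rfl
    rw [hd] at hdim
    exact lt_irrefl _ hdim
  have ha : Set.range a ⊆ IsLocalRing.maximalIdeal A := by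
    rw [← hrad]
    exact Ideal.subset_span.trans Ideal.le_radical
  have hsop : ∀ {e : ℕ} (b : Fin e → A), Set.range b ⊆ IsLocalRing.maximalIdeal A →
      ringKrullDim A = e → IsLocalRing.maximalIdeal A ≤ (Ideal.span (Set.range b)).radical →
      (Ideal.span (Set.range b)).IsDualizing := by
    intro e b hb he hr K hK w hw
    refine Ideal.HasGorensteinQuotient.exists_mul_notMem ?_ hK hw
    exact Ideal.hasGorensteinQuotient_span hN b Fin.elim0 (by simpa using he) hb (by simp)
      (hr.trans (Ideal.radical_mono le_sup_left))
  have hdual := hsop a ha hd hrad.ge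
  have hmemI : ∀ x, x ∈ I →
      ∀ t ∈ IsLocalRing.maximalIdeal A ^ 2, x * t ∈ Ideal.span (Set.range a) := by
    intro x hx t ht
    rw [hI] at hx
    exact Submodule.mem_colon.mp hx t ht
  have hv : ∀ z ∈ IsLocalRing.maximalIdeal A, ∃ w ∈ IsLocalRing.maximalIdeal A,
      w ∉ IsLocalRing.maximalIdeal A ^ 2 ⊔ Ideal.span (Set.range a) ⊔ Ideal.span {z} := by
    intro z hz
    by_contra! hcon
    have h1 := embeddingDim_quotient_le (Q := Ideal.span (Set.range a)) (v := ![z])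
      (by simpa using hz) (by
        rw [Matrix.range_cons, Matrix.range_empty, Set.union_empty]
        exact hcon)
    rw [← hn] at h1
    exact absurd hn1 (not_lt.mpr h1)
  by_cases hmul : ∀ y ∈ IsLocalRing.maximalIdeal A, ∀ x, (∀ t ∈ IsLocalRing.maximalIdeal A ^ 2,
      x * t ∈ Ideal.span (Set.range a)) → y * x ∈ Ideal.span (Set.range a) →
      y * x ∈ IsLocalRing.maximalIdeal A * Ideal.span (Set.range a)
  · refine absurd (fun x hx => ?_) hnot
    refine isIntegralOverIdeal_of_mul_mem (M := IsLocalRing.maximalIdeal A ^ 2)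
      (IsNoetherian.noetherian _)
      (fun t ht => mul_mem_of_forall_mul_mem hdual hv hmul (hmemI x hx) ht) ?_
    intro z hz
    have h0 : a 0 ∈ nonZeroDivisors A := by
      refine mem_nonZeroDivisors_of_isSystemOfParameters hN hd (a 0) (Fin.tail a) ?_
        ((Set.range_comp_subset_range _ _).trans ha)
      rw [← hrad]
      apply Ideal.radical_mono
      conv_lhs => rw [← Fin.cons_self_tail a, Fin.range_cons, Set.insert_eq, Ideal.span_union]
    have h1 := hz (a 0 ^ 2) (Ideal.pow_mem_pow (ha ⟨0, rfl⟩) 2)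
    exact mem_nonZeroDivisors_iff_left.mp (pow_mem h0 2) z h1
  · push Not at hmul
    obtain ⟨y, hy, x, hx, hyx, hyxm⟩ := hmul
    obtain ⟨b, hba, hab⟩ := Ideal.exists_span_eq_sup_of_notMem_mul a hyx hyxm
    have hb : Set.range b ⊆ IsLocalRing.maximalIdeal A := hba.trans ha
    have hyxm' : y * x ∈ IsLocalRing.maximalIdeal A := Ideal.mul_mem_right _ _ hy
    have hG : (Ideal.span (Set.range b)).HasGorensteinQuotient 1 := by
      refine Ideal.hasGorensteinQuotient_span hN b ![y * x] hd hb (by simpa using hyxm') ?_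
      rw [← hrad, hab]
      simp
    have hreg : ∀ r, r * (y * x) ∈ Ideal.span (Set.range b) → r ∈ Ideal.span (Set.range b) := by
      refine (Ideal.HasGorensteinQuotient.sup_span_singleton (c := 0) hG (b := Fin.elim0) hyxm'
        (by simp) ?_).1
      rw [← hrad, hab, ← sup_assoc]
      exact Ideal.radical_mono le_sup_left
    have hK := maximalIdeal_sq_le_of_mul_mem hreg (by rwa [← hab])
    have hspan : Ideal.span (Set.range (Fin.cons y b : Fin (c + 1) → A)) =
        Ideal.span (Set.range b) ⊔ Ideal.span {y} := by
      rw [Fin.range_cons, Set.insert_eq, Ideal.span_union, sup_comm]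
    have hyb : Set.range (Fin.cons y b : Fin (c + 1) → A) ⊆ IsLocalRing.maximalIdeal A := by
      rw [Fin.range_cons]
      exact Set.insert_subset hy hb
    have hKd := hsop (Fin.cons y b) hyb hd (by
      rw [hspan]
      exact fun t ht => ⟨2, hK (Ideal.pow_mem_pow ht 2)⟩)
    rw [hspan] at hKd
    obtain ⟨w, hw, hwK⟩ := hKd.exists_maximalIdeal_le hK
    constructor
    · refine localMultiplicity_le_of_length_le hd (Fin.cons y b) hyb ?_
      rw [hspan]
      exact length_quotient_le_two hw hK hwK
    · refine le_antisymm ?_ (Order.add_one_le_of_lt hn1)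
      rw [hn]
      refine embeddingDim_quotient_le (v := ![y, w]) ?_ ?_
      · rintro _ ⟨i, rfl⟩
        fin_cases i
        · exact hy
        · exact hw
      · refine hwK.trans (sup_le (sup_le ?_ ?_) ?_)
        · exact le_sup_of_le_left (le_sup_of_le_right (hab ▸ le_sup_left))
        · exact le_sup_of_le_right (Ideal.span_mono (by simp))
        · exact le_sup_of_le_right (Ideal.span_mono (by simp))
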